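/- Let $A(t)=(a_{ij}(t))_{i,j=1}^N$, $t\ge 0$, be an $N\times N$ matrix of measurable, non-negative functions with $a_{ii}(t)=0$, regarded as the weights of a time-varying directed graph $G(t)$ on the nodes $\{1,\dots,N\}$ without self-loops, and let $L(t)=(l_{ij}(t))$ be its Laplacian, $l_{ij}=-a_{ij}$ for $i\ne j$ and $l_{ii}=\sum_{j\ne i}a_{ij}$. A solution of the differential inequality $$\dot x(t)\le -L(t)x(t),\qquad t\ge 0,\qquad (*)$$ is a function $x:[0,\infty)\to\mathbb R^N$ that is absolutely continuous on every compact interval $[0,T]$ and satisfies $(*)$ componentwise for almost every $t\ge 0$. The inequality $(*)$ is called dichotomic if every bounded solution has a limit $\lim_{t\to\infty}x(t)\in\mathbb R^N$, and consensus dichotomic if moreover each such limit has the form $c\,(1,\dots,1)^\top$ with $c\in\mathbb R$. The graph $G(t)$ is infinitely strongly connected (ISC) if the directed graph on $\{1,\dots,N\}$ with the set of arcs $\{(i,j):\int_0^\infty a_{ji}(t)\,dt=\infty\}$ is strongly connected. Assume that the functions $a_{ij}$ are bounded and that $G(t)$ is cut-balanced, i.e. there is a constant $K\ge 1$ such that for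 every $S\subset\{1,\dots,N\}$ and every $t\ge 0$ $$K^{-1}\sum_{j\in S}\sum_{k\notin S}a_{kj}(t)\le\sum_{j\in S}\sum_{k\notin S}a_{jk}(t)\le K\sum_{j\in S}\sum_{k\notin S}a_{kj}(t).$$ Then: 1. the inequality $(*)$ is dichotomic; 2. for every bounded solution $x$ of $(*)$ and all $i,j$, the functions $a_{ij}(x_j-x_i)$, $\dot x_i$ and the components of $\mathfrak D(t)=-L(t)x(t)-\dot x(t)$ belong to $L_1[0,\infty)$; 3. the inequality $(*)$ is consensus dichotomic if and only if $G(t)$ is ISC. -/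

import Mathlib

open MeasureTheory Set Filter Topology

/-- The Laplacian matrix `L[A]` of a weighted graph with adjacency matrix `A`:
`l i j = - a i j` off the diagonal and `l i i = ∑_{j ≠ i} a i j`. -/
def laplacian {N : ℕ} (A : Matrix (Fin N) (Fin N) ℝ) : Matrix (Fin N) (Fin N) ℝ :=
  Matrix.of fun i j => if i = j then ∑ k ∈ Finset.univ.erase i, A i k else - A i j

/-- A solution of the differential inequality `ẋ(t) ≤ - L(t) x(t)` on `[0, ∞)`: a function that is
absolutely continuous (on every compact interval `[0, T]`) and satisfies the inequality
componentwise for almost every `t ≥ 0`. Values of `A` and `x` at negative times play no role. -/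
def IsSolution {N : ℕ} (A : ℝ → Matrix (Fin N) (Fin N) ℝ) (x : ℝ → Fin N → ℝ) : Prop :=
  (∀ i : Fin N, ∀ T : ℝ, 0 ≤ T → AbsolutelyContinuousOnInterval (fun t => x t i) 0 T) ∧
  ∀ᵐ t ∂(volume.restrict (Ici (0 : ℝ))), ∀ i : Fin N,
    deriv (fun s => x s i) t ≤ - (laplacian (A t)).mulVec (x t) i

/-- `x` is bounded on `[0, ∞)`. -/
def IsBoundedOnHalfLine {N : ℕ} (x : ℝ → Fin N → ℝ) : Prop :=
  ∃ C : ℝ, ∀ t : ℝ, 0 ≤ t → ∀ i : Fin N, |x t i| ≤ C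

/-- The inequality is dichotomic: each bounded solution has a limit at infinity. -/
def Dichotomic {N : ℕ} (A : ℝ → Matrix (Fin N) (Fin N) ℝ) : Prop :=
  ∀ x : ℝ → Fin N → ℝ, IsSolution A x → IsBoundedOnHalfLine x →
    ∃ x₀ : Fin N → ℝ, Tendsto x atTop (𝓝 x₀)

/-- The inequality is consensus dichotomic: it is dichotomic and all limits of bounded solutions
are consensus vectors `c • (1, …, 1)`. -/
def ConsensusDichotomic {N : ℕ} (A : ℝ → Matrix (Fin N) (Fin N) ℝ) : Prop :=
  Dichotomic A ∧
  ∀ x : ℝ → Fin N → ℝ, IsSolution A x → IsBoundedOnHalfLine x →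
    ∀ x₀ : Fin N → ℝ, Tendsto x atTop (𝓝 x₀) → ∃ c : ℝ, x₀ = fun _ => c

/-- The graph is cut-balanced. -/
def CutBalanced {N : ℕ} (A : ℝ → Matrix (Fin N) (Fin N) ℝ) : Prop :=
  ∃ K : ℝ, 1 ≤ K ∧ ∀ S : Finset (Fin N), ∀ t : ℝ, 0 ≤ t →
    K⁻¹ * ∑ j ∈ S, ∑ k ∈ Sᶜ, A t k j ≤ ∑ j ∈ S, ∑ k ∈ Sᶜ, A t j k ∧
    ∑ j ∈ S, ∑ k ∈ Sᶜ, A t j k ≤ K * ∑ j ∈ S, ∑ k ∈ Sᶜ, A t k j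

/-- `(i, j)` is an arc of the graph of persistent interactions: `∫₀^∞ a_{ji}(t) dt = ∞`. -/
def PersistentArc {N : ℕ} (A : ℝ → Matrix (Fin N) (Fin N) ℝ) (i j : Fin N) : Prop :=
  ∫⁻ t in Ici (0 : ℝ), ENNReal.ofReal (A t j i) = ⊤

/-- Infinite strong connectivity (ISC): the graph of persistent arcs is strongly connected,
that is, there is a walk from every node to every node. -/
def InfinitelyStronglyConnected {N : ℕ} (A : ℝ → Matrix (Fin N) (Fin N) ℝ) : Prop :=
  ∀ i j : Fin N, Relation.ReflTransGen (PersistentArc A) i j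

/-! The Lyapunov function is the maximum over permutations `σ` of `∑ i, (2K)^(σ i) * x i`. By
rearrangement a permutation sorting `x` attains it, and for sorted weights cut balance makes the
weighted sum of the right-hand sides at most `-1/2 ∑ a i j |x j - x i|`
(`exists_perm_maximal_dissipation`). A bounded solution keeps this function bounded, so the
interaction terms are integrable (`IsSolution.integrableOn_interaction`). Each `x i` is then bounded
with derivative below an integrable function, hence has integrable derivative and a limit.

A persistent arc forces equal limits at its ends, as otherwise its interaction term would not be
integrable; thus ISC gives consensus. Without ISC, the nodes reachable from a suitable node form a
proper subset that no persistent arc leaves, and `exists_isSolution_of_no_persistentArc` gives a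
bounded solution whose limit is not a consensus. -/

lemma neg_laplacian_mulVec {N : ℕ} (a : Matrix (Fin N) (Fin N) ℝ) (x : Fin N → ℝ) (i : Fin N) :
    - (laplacian a).mulVec x i = ∑ j, a i j * (x j - x i) := by
  have h1 : (laplacian a).mulVec x i = ∑ j, laplacian a i j * x j := rfl
  rw [h1, ← Finset.add_sum_erase _ _ (Finset.mem_univ i),
    ← Finset.add_sum_erase (a := i) _ (fun j => a i j * (x j - x i)) (Finset.mem_univ i)]
  have h2 : ∑ j ∈ Finset.univ.erase i, laplacian a i j * x j
      = ∑ j ∈ Finset.univ.erase i, - (a i j * x j) := by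
    refine Finset.sum_congr rfl fun j hj => ?_
    simp [laplacian, (Finset.ne_of_mem_erase hj).symm]
  rw [h2]
  simp only [laplacian, Matrix.of_apply, if_true, Finset.sum_neg_distrib, mul_sub,
    Finset.sum_sub_distrib, Finset.sum_mul]
  ring

/-! ### Dissipation under cut balance, at a fixed time. -/

lemma sum_sum_compl_eq {ι : Type*} [Fintype ι] [DecidableEq ι] (S : Finset ι) (f : ι → ι → ℝ) :
    ∑ j ∈ S, ∑ k ∈ Sᶜ, f j k = ∑ j, ∑ k, if j ∈ S ∧ k ∉ S then f j k else 0 := by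
  rw [← Finset.sum_filter_add_sum_filter_not Finset.univ (· ∈ S)]
  have h1 : ∑ j ∈ Finset.univ.filter (· ∉ S), ∑ k, (if j ∈ S ∧ k ∉ S then f j k else 0) = 0 :=
    Finset.sum_eq_zero fun j hj => by
      have : j ∉ S := by simpa using hj
      simp [this]
  rw [h1, add_zero, Finset.filter_mem_eq_inter, Finset.univ_inter]
  refine Finset.sum_congr rfl fun j hj => ?_
  simp only [hj, true_and, ← Finset.sum_filter]
  congr 1
  ext k
  simp

/-- The dissipation estimate for the indicator of an upper set of the ranking `r`. -/
lemma sum_weight_mul_indicator_le {N : ℕ} {a : Fin N → Fin N → ℝ} (ha : ∀ i j, 0 ≤ a i j) {K : ℝ}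
    (hK : 1 ≤ K)
    (hcut : ∀ S : Finset (Fin N),
      K⁻¹ * ∑ j ∈ S, ∑ k ∈ Sᶜ, a k j ≤ ∑ j ∈ S, ∑ k ∈ Sᶜ, a j k ∧
      ∑ j ∈ S, ∑ k ∈ Sᶜ, a j k ≤ K * ∑ j ∈ S, ∑ k ∈ Sᶜ, a k j)
    (r : Fin N → ℕ) (m : ℕ) (u : Fin N → ℝ) (hu : ∀ i, u i = if m < r i then 1 else 0) :
    ∑ i, (2 * K) ^ (r i) * ∑ j, a i j * (u j - u i) ≤
      - (1 / 2 * ∑ i, ∑ j, a i j * |u j - u i|) := by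
  set S : Finset (Fin N) := Finset.univ.filter fun i => ¬ m < r i with hS
  have memS : ∀ i, i ∈ S ↔ ¬ m < r i := by simp [hS]
  obtain ⟨h1, h2⟩ := hcut S
  set P := ∑ j ∈ S, ∑ k ∈ Sᶜ, a j k with hP
  set Q := ∑ j ∈ S, ∑ k ∈ Sᶜ, a k j with hQ
  have hK0 : 0 < K := by linarith
  have hP0 : 0 ≤ P := Finset.sum_nonneg fun _ _ => Finset.sum_nonneg fun _ _ => ha _ _
  have hQ0 : 0 ≤ Q := Finset.sum_nonneg fun _ _ => Finset.sum_nonneg fun _ _ => ha _ _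
  rw [sum_sum_compl_eq] at hP hQ
  rw [Finset.sum_comm] at hQ
  have hw : 1 ≤ (2 * K) ^ m := one_le_pow₀ (by linarith)
  have habs : ∑ i, ∑ j, a i j * |u j - u i| = P + Q := by
    rw [hP, hQ]
    simp only [← Finset.sum_add_distrib]
    refine Finset.sum_congr rfl fun i _ => Finset.sum_congr rfl fun j _ => ?_
    simp only [memS, hu]
    by_cases hi : m < r i <;> by_cases hj : m < r j <;> simp [hi, hj]
  -- Rows in `S` contribute positively with weight at most `(2K)^m`, the others negatively with
  -- weight at least `(2K)^(m+1)`.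
  have hle : ∑ i, (2 * K) ^ (r i) * ∑ j, a i j * (u j - u i) ≤
      (2 * K) ^ m * P - (2 * K) ^ (m + 1) * Q := by
    rw [hP, hQ]
    simp only [Finset.mul_sum, ← Finset.sum_sub_distrib]
    refine Finset.sum_le_sum fun i _ => Finset.sum_le_sum fun j _ => ?_
    simp only [memS, hu]
    by_cases hi : m < r i <;> by_cases hj : m < r j <;> simp [hi, hj]
    · exact mul_le_mul_of_nonneg_right (pow_le_pow_right₀ (by linarith) hi) (ha _ _)
    · exact mul_le_mul_of_nonneg_right (pow_le_pow_right₀ (by linarith) (by omega)) (ha _ _)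
  rw [habs]
  refine hle.trans ?_
  have hKQ : Q ≤ K * Q := by nlinarith
  -- The base `2K` is chosen for this: `P ≤ K Q` and `Q ≤ K Q` give `3/2 P + 1/2 Q ≤ 2 K Q`.
  have h3 : P - 2 * K * Q ≤ - (1 / 2 * (P + Q)) := by linarith
  have h4 : (2 * K) ^ m * (P - 2 * K * Q) ≤ 1 * (P - 2 * K * Q) :=
    mul_le_mul_of_nonpos_right hw (by linarith)
  calc _ = (2 * K) ^ m * (P - 2 * K * Q) := by ring
    _ ≤ _ := by linarith

/-- The dissipation estimate: for a cut-balanced weight matrix `a` and an increasing ranking of the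
entries of `x`, the exponentially weighted sum of the consensus terms is negative enough. -/
lemma sum_weight_mul_le_of_cutBalanced {N : ℕ} {a : Fin N → Fin N → ℝ} (ha : ∀ i j, 0 ≤ a i j)
    {K : ℝ} (hK : 1 ≤ K)
    (hcut : ∀ S : Finset (Fin N),
      K⁻¹ * ∑ j ∈ S, ∑ k ∈ Sᶜ, a k j ≤ ∑ j ∈ S, ∑ k ∈ Sᶜ, a j k ∧
      ∑ j ∈ S, ∑ k ∈ Sᶜ, a j k ≤ K * ∑ j ∈ S, ∑ k ∈ Sᶜ, a k j)
    (r : Fin N → ℕ) (hr : ∀ i, r i < N) (y : ℕ → ℝ) (hy : Monotone y) :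
    ∑ i, (2 * K) ^ (r i) * ∑ j, a i j * (y (r j) - y (r i)) ≤
      - (1 / 2 * ∑ i, ∑ j, a i j * |y (r j) - y (r i)|) := by
  set u : ℕ → Fin N → ℝ := fun m i => if m < r i then 1 else 0 with hu
  set g : ℕ → ℝ := fun m => y (m + 1) - y m with hg
  have hg0 : ∀ m, 0 ≤ g m := fun m => sub_nonneg.2 (hy m.le_succ)
  -- Layer-cake decomposition: a monotone function of the rank is a constant plus a nonnegative
  -- combination of indicators of upper sets, which reduces the estimate to cuts.
  have hyr : ∀ i, y (r i) = y 0 + ∑ m ∈ Finset.range N, g m * u m i := by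
    intro i
    have h1 := Finset.sum_range_sub y (r i)
    have h2 : ∑ m ∈ Finset.range N, g m * u m i = ∑ m ∈ Finset.range (r i), g m := by
      simp only [hu, mul_ite, mul_one, mul_zero, ← Finset.sum_filter]
      congr 1
      ext m
      have := hr i
      simp only [Finset.mem_filter, Finset.mem_range]
      omega
    rw [h2, h1]
    ring
  have hdiff : ∀ i j, y (r j) - y (r i) = ∑ m ∈ Finset.range N, g m * (u m j - u m i) := by
    intro i j
    rw [hyr i, hyr j]
    simp only [mul_sub, Finset.sum_sub_distrib]
    ring
  have hL : ∑ i, (2 * K) ^ (r i) * ∑ j, a i j * (y (r j) - y (r i)) =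
      ∑ m ∈ Finset.range N, g m * ∑ i, (2 * K) ^ (r i) * ∑ j, a i j * (u m j - u m i) := by
    simp only [hdiff, Finset.mul_sum]
    rw [Finset.sum_comm' (s := Finset.range N) (t' := Finset.univ) (s' := fun _ => Finset.range N)
      (by simp)]
    refine Finset.sum_congr rfl fun i _ => ?_
    rw [Finset.sum_comm]
    refine Finset.sum_congr rfl fun m _ => Finset.sum_congr rfl fun j _ => by ring
  have hR : ∑ i, ∑ j, a i j * |y (r j) - y (r i)| ≤
      ∑ m ∈ Finset.range N, g m * ∑ i, ∑ j, a i j * |u m j - u m i| := by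
    simp only [Finset.mul_sum]
    rw [Finset.sum_comm (s := Finset.range N)]
    refine Finset.sum_le_sum fun i _ => ?_
    rw [Finset.sum_comm]
    refine Finset.sum_le_sum fun j _ => ?_
    rw [hdiff]
    calc _ ≤ a i j * ∑ m ∈ Finset.range N, |g m * (u m j - u m i)| :=
          mul_le_mul_of_nonneg_left (Finset.abs_sum_le_sum_abs _ _) (ha i j)
      _ = _ := by
          rw [Finset.mul_sum]
          refine Finset.sum_congr rfl fun m _ => ?_
          rw [abs_mul, abs_of_nonneg (hg0 m)]
          ring
  rw [hL]
  calc _ ≤ ∑ m ∈ Finset.range N, g m * - (1 / 2 * ∑ i, ∑ j, a i j * |u m j - u m i|) :=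
        Finset.sum_le_sum fun m _ => mul_le_mul_of_nonneg_left
          (sum_weight_mul_indicator_le ha hK hcut r m (u m) fun _ => rfl) (hg0 m)
    _ = - (1 / 2 * ∑ m ∈ Finset.range N, g m * ∑ i, ∑ j, a i j * |u m j - u m i|) := by
        rw [Finset.mul_sum, ← Finset.sum_neg_distrib]
        refine Finset.sum_congr rfl fun m _ => by ring
    _ ≤ _ := by linarith

/-- Every vector admits a ranking whose exponentially weighted sum is maximal among permutations and
for which the dissipation estimate holds. -/
lemma exists_perm_maximal_dissipation {N : ℕ} {a : Fin N → Fin N → ℝ} (ha : ∀ i j, 0 ≤ a i j)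
    {K : ℝ} (hK : 1 ≤ K)
    (hcut : ∀ S : Finset (Fin N),
      K⁻¹ * ∑ j ∈ S, ∑ k ∈ Sᶜ, a k j ≤ ∑ j ∈ S, ∑ k ∈ Sᶜ, a j k ∧
      ∑ j ∈ S, ∑ k ∈ Sᶜ, a j k ≤ K * ∑ j ∈ S, ∑ k ∈ Sᶜ, a k j)
    (x : Fin N → ℝ) :
    ∃ σ : Equiv.Perm (Fin N),
      (∀ τ : Equiv.Perm (Fin N),
        ∑ i, (2 * K) ^ (τ i : ℕ) * x i ≤ ∑ i, (2 * K) ^ (σ i : ℕ) * x i) ∧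
      ∑ i, (2 * K) ^ (σ i : ℕ) * ∑ j, a i j * (x j - x i) ≤
        - (1 / 2 * ∑ i, ∑ j, a i j * |x j - x i|) := by
  rcases Nat.eq_zero_or_pos N with rfl | hN
  · exact ⟨1, by simp, by simp⟩
  set ρ := Tuple.sort x with hρ
  have hmono : Monotone (x ∘ ρ) := Tuple.monotone_sort x
  refine ⟨ρ.symm, fun τ => ?_, ?_⟩
  · have hvary : Monovary (fun k : Fin N => (2 * K) ^ (k : ℕ)) (x ∘ ρ) := by
      have hw : Monotone (fun k : Fin N => (2 * K) ^ (k : ℕ)) := fun i j hij =>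
        pow_le_pow_right₀ (by linarith) hij
      exact hw.monovary hmono
    have := hvary.sum_comp_perm_mul_le_sum_mul (σ := ρ.trans τ)
    rw [← Equiv.sum_comp ρ, ← Equiv.sum_comp ρ (fun i => (2 * K) ^ (ρ.symm i : ℕ) * x i)]
    simpa using this
  -- Clamping at `N - 1` extends the sorted vector to a monotone sequence on all of `ℕ`.
  · set y : ℕ → ℝ := fun n => x (ρ ⟨min n (N - 1), by omega⟩) with hy
    have hy_mono : Monotone y := fun m n hmn =>
      hmono (show (⟨min m (N - 1), _⟩ : Fin N) ≤ ⟨min n (N - 1), _⟩ from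
        min_le_min_right (N - 1) hmn)
    have hx : ∀ i, y (ρ.symm i : ℕ) = x i := by
      intro i
      have h1 : (⟨min (ρ.symm i : ℕ) (N - 1), by omega⟩ : Fin N) = ρ.symm i := by
        ext
        have := (ρ.symm i).2
        simp only
        omega
      simp only [hy, h1, Equiv.apply_symm_apply]
    simpa only [hx] using sum_weight_mul_le_of_cutBalanced ha hK hcut (fun i => (ρ.symm i : ℕ))
      (fun i => (ρ.symm i).2) y hy_mono

/-! ### Absolutely continuous functions on the half-line. -/

lemma AbsolutelyContinuousOnInterval.finset_sum {ι : Type*} (s : Finset ι) {f : ι → ℝ → ℝ}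
    {a b : ℝ} (hf : ∀ i ∈ s, AbsolutelyContinuousOnInterval (f i) a b) :
    AbsolutelyContinuousOnInterval (fun t => ∑ i ∈ s, f i t) a b := by
  classical
  induction s using Finset.induction_on with
  | empty =>
    simpa using (LipschitzWith.const (0 : ℝ)).lipschitzOnWith.absolutelyContinuousOnInterval
  | insert i s hi ih =>
    simp only [Finset.sum_insert hi]
    exact (hf i (by simp)).fun_add (ih fun j hj => hf j (by simp [hj]))

/-- An increment of the maximum is bounded by the sum of the increments of the members. This gives
regularity of the Lyapunov function even though the maximizing permutation changes with time. -/
lemma AbsolutelyContinuousOnInterval.finset_sup' {ι : Type*} (s : Finset ι) (hs : s.Nonempty)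
    {f : ι → ℝ → ℝ} {a b : ℝ} (hf : ∀ i ∈ s, AbsolutelyContinuousOnInterval (f i) a b) :
    AbsolutelyContinuousOnInterval (fun t => s.sup' hs fun i => f i t) a b := by
  have key : ∀ p q : ℝ, s.sup' hs (fun i => f i p) - s.sup' hs (fun i => f i q) ≤
      ∑ i ∈ s, dist (f i p) (f i q) := by
    intro p q
    rw [sub_le_iff_le_add]
    refine Finset.sup'_le _ _ fun i hi => ?_
    have h1 := Finset.le_sup' (fun i => f i q) hi
    have h2 : dist (f i p) (f i q) ≤ ∑ i ∈ s, dist (f i p) (f i q) :=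
      Finset.single_le_sum (f := fun i => dist (f i p) (f i q)) (fun _ _ => dist_nonneg) hi
    have h3 := le_abs_self (f i p - f i q)
    rw [Real.dist_eq] at h2
    linarith
  have key' : ∀ p q : ℝ, dist (s.sup' hs fun i => f i p) (s.sup' hs fun i => f i q) ≤
      ∑ i ∈ s, dist (f i p) (f i q) := by
    intro p q
    rw [Real.dist_eq, abs_le]
    have h1 := key p q
    have h2 := key q p
    have h3 : ∑ i ∈ s, dist (f i q) (f i p) = ∑ i ∈ s, dist (f i p) (f i q) :=
      Finset.sum_congr rfl fun i _ => dist_comm _ _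
    constructor <;> linarith
  have hlim := tendsto_finsetSum (a := fun _ => (0 : ℝ)) s hf
  rw [Finset.sum_const_zero] at hlim
  refine squeeze_zero (fun E => Finset.sum_nonneg fun _ _ => dist_nonneg) (fun E => ?_) hlim
  rw [Finset.sum_comm]
  exact Finset.sum_le_sum fun k _ => key' _ _

lemma LipschitzOnWith.comp_absolutelyContinuousOnInterval {g : ℝ → ℝ} {K : NNReal} {s : Set ℝ}
    (hg : LipschitzOnWith K g s) {f : ℝ → ℝ} {a b : ℝ} (hfs : MapsTo f (uIcc a b) s)
    (hf : AbsolutelyContinuousOnInterval f a b) :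
    AbsolutelyContinuousOnInterval (fun t => g (f t)) a b := by
  have hlim := Tendsto.const_mul (K : ℝ) hf
  rw [mul_zero] at hlim
  refine squeeze_zero' (Eventually.of_forall fun E => Finset.sum_nonneg fun _ _ => dist_nonneg)
    (eventually_inf_principal.2 (Eventually.of_forall fun E hE => ?_)) hlim
  rw [Finset.mul_sum]
  exact Finset.sum_le_sum fun k hk =>
    hg.dist_le_mul _ (hfs (hE.1 k hk).1) _ (hfs (hE.1 k hk).2)

/-- At a common point of differentiability, the derivative of a function dominating `f` and
touching it there is the derivative of `f`. -/
lemma deriv_eq_of_le_of_eq {f g : ℝ → ℝ} {t : ℝ} (hf : DifferentiableAt ℝ f t)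
    (hg : DifferentiableAt ℝ g t) (hle : ∀ s, f s ≤ g s) (heq : f t = g t) :
    deriv g t = deriv f t := by
  have hmin : IsLocalMin (g - f) t := Eventually.of_forall fun s => by
    simp only [Pi.sub_apply, heq, sub_self]
    exact sub_nonneg.2 (hle s)
  have := hmin.deriv_eq_zero
  rw [deriv_sub hg hf] at this
  linarith

/-- A function absolutely continuous on each `[0, T]` is a.e. differentiable on `[0, ∞)`. -/
lemma ae_differentiableAt_Ici {f : ℝ → ℝ}
    (hf : ∀ T : ℝ, 0 ≤ T → AbsolutelyContinuousOnInterval f 0 T) :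
    ∀ᵐ t ∂(volume.restrict (Ici (0 : ℝ))), DifferentiableAt ℝ f t := by
  rw [ae_restrict_iff' measurableSet_Ici]
  have h : ∀ᵐ t : ℝ, ∀ n : ℕ, t ∈ uIcc (0 : ℝ) n → DifferentiableAt ℝ f t :=
    ae_all_iff.2 fun n => (hf n n.cast_nonneg).ae_differentiableAt
  filter_upwards [h] with t ht h0
  obtain ⟨n, hn⟩ := exists_nat_ge t
  exact ht n (by rw [uIcc_of_le n.cast_nonneg]; exact ⟨h0, hn⟩)

lemma continuousOn_Ici_of_absolutelyContinuous {f : ℝ → ℝ}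
    (hf : ∀ T : ℝ, 0 ≤ T → AbsolutelyContinuousOnInterval f 0 T) :
    ContinuousOn f (Ici (0 : ℝ)) := by
  intro t ht
  have ht0 : (0 : ℝ) ≤ t := ht
  have h := (hf (t + 1) (by linarith)).continuousOn
  rw [uIcc_of_le (by linarith)] at h
  refine (h t ⟨ht, by linarith⟩).mono_of_mem_nhdsWithin ?_
  filter_upwards [self_mem_nhdsWithin, mem_nhdsWithin_of_mem_nhds (Iio_mem_nhds (lt_add_one t))]
    with s h1 h2
  exact ⟨h1, le_of_lt h2⟩

/-- If a bounded function, absolutely continuous on each `[0, T]`, has derivative bounded above by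
an integrable function, then its derivative is integrable. -/
lemma integrableOn_deriv_of_le {f φ : ℝ → ℝ}
    (hf : ∀ T : ℝ, 0 ≤ T → AbsolutelyContinuousOnInterval f 0 T)
    (hb : ∃ C : ℝ, ∀ t : ℝ, 0 ≤ t → |f t| ≤ C) (hφ : IntegrableOn φ (Ici (0 : ℝ)))
    (hle : ∀ᵐ t ∂(volume.restrict (Ici (0 : ℝ))), deriv f t ≤ φ t) :
    IntegrableOn (deriv f) (Ici (0 : ℝ)) := by
  obtain ⟨C, hC⟩ := hb
  have hφ' : IntegrableOn φ (Ioi 0) := hφ.mono_set Ioi_subset_Ici_self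
  rw [integrableOn_Ici_iff_integrableOn_Ioi]
  have hφn : ∀ n : ℕ, IntervalIntegrable φ volume 0 n := fun n => by
    rw [intervalIntegrable_iff_integrableOn_Ioc_of_le n.cast_nonneg]
    exact hφ'.mono_set Ioc_subset_Ioi_self
  have hfn : ∀ n : ℕ, IntervalIntegrable (deriv f) volume 0 n := fun n =>
    (hf n n.cast_nonneg).intervalIntegrable_deriv
  -- The difference is nonnegative a.e., so its `L₁` norm on `[0, n]` is its integral, which is
  -- bounded uniformly in `n` by the fundamental theorem of calculus.
  have key : IntegrableOn (fun t => φ t - deriv f t) (Ioi 0) := by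
    refine integrableOn_Ioi_of_intervalIntegral_norm_bounded
      ((∫ t in Ioi (0 : ℝ), ‖φ t‖) + 2 * C) 0 (l := atTop) (b := fun n : ℕ => (n : ℝ)) ?_
      tendsto_natCast_atTop_atTop (Eventually.of_forall fun n => ?_)
    · intro n
      exact (intervalIntegrable_iff_integrableOn_Ioc_of_le n.cast_nonneg).1 ((hφn n).sub (hfn n))
    · have h1 : ∫ t in (0 : ℝ)..n, ‖φ t - deriv f t‖ = ∫ t in (0 : ℝ)..n, (φ t - deriv f t) := by
        refine intervalIntegral.integral_congr_ae ?_
        rw [ae_restrict_iff' measurableSet_Ici] at hle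
        filter_upwards [hle] with t ht hmem
        rw [uIoc_of_le n.cast_nonneg] at hmem
        exact Real.norm_of_nonneg (sub_nonneg.2 (ht hmem.1.le))
      rw [h1, intervalIntegral.integral_sub (hφn n) (hfn n),
        (hf n n.cast_nonneg).integral_deriv_eq_sub]
      have h2 : ∫ t in (0 : ℝ)..n, φ t ≤ ∫ t in Ioi (0 : ℝ), ‖φ t‖ := by
        rw [intervalIntegral.integral_of_le n.cast_nonneg]
        refine (Real.le_norm_self _).trans ((norm_integral_le_integral_norm _).trans ?_)
        exact setIntegral_mono_set hφ'.norm (Eventually.of_forall fun _ => norm_nonneg _)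
          Ioc_subset_Ioi_self.eventuallyLE
      have h3 := (abs_le.1 (hC n n.cast_nonneg)).1
      have h4 := (abs_le.1 (hC 0 le_rfl)).2
      linarith
  have := hφ'.sub key
  refine this.congr (Eventually.of_forall fun t => ?_)
  simp

lemma tendsto_of_integrableOn_deriv {f : ℝ → ℝ}
    (hf : ∀ T : ℝ, 0 ≤ T → AbsolutelyContinuousOnInterval f 0 T)
    (hint : IntegrableOn (deriv f) (Ici (0 : ℝ))) : ∃ l : ℝ, Tendsto f atTop (𝓝 l) := by
  refine ⟨f 0 + ∫ t in Ioi (0 : ℝ), deriv f t, ?_⟩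
  have h := (intervalIntegral_tendsto_integral_Ioi 0 (hint.mono_set Ioi_subset_Ici_self)
    tendsto_id).const_add (f 0)
  refine h.congr' ?_
  filter_upwards [eventually_ge_atTop 0] with T hT
  rw [id, (hf T hT).integral_deriv_eq_sub]
  ring

/-! ### Bounded solutions, persistent arcs and the counterexample. -/

section

variable {N : ℕ} {A : ℝ → Matrix (Fin N) (Fin N) ℝ}

lemma IsSolution.ae_deriv_le_sum {x : ℝ → Fin N → ℝ} (hx : IsSolution A x) :
    ∀ᵐ t ∂(volume.restrict (Ici (0 : ℝ))), ∀ i : Fin N,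
      deriv (fun s => x s i) t ≤ ∑ j, A t i j * (x t j - x t i) := by
  filter_upwards [hx.2] with t ht i
  rw [← neg_laplacian_mulVec]
  exact ht i

lemma IsSolution.continuousOn {x : ℝ → Fin N → ℝ} (hx : IsSolution A x) (i : Fin N) :
    ContinuousOn (fun t => x t i) (Ici (0 : ℝ)) :=
  continuousOn_Ici_of_absolutelyContinuous (hx.1 i)

/-- Along a bounded solution of a cut-balanced inequality, the interaction terms are integrable. -/
lemma IsSolution.integrableOn_interaction
    (hmeas : ∀ i j : Fin N, AEMeasurable (fun t => A t i j) (volume.restrict (Ici (0 : ℝ))))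
    (hnonneg : ∀ t : ℝ, 0 ≤ t → ∀ i j : Fin N, 0 ≤ A t i j) (hcut : CutBalanced A)
    {x : ℝ → Fin N → ℝ} (hx : IsSolution A x) (hb : IsBoundedOnHalfLine x) (i j : Fin N) :
    IntegrableOn (fun t => A t i j * (x t j - x t i)) (Ici (0 : ℝ)) := by
  obtain ⟨K, hK, hcut⟩ := hcut
  obtain ⟨C, hC⟩ := hb
  set f : Equiv.Perm (Fin N) → ℝ → ℝ := fun σ t => ∑ i, (2 * K) ^ (σ i : ℕ) * x t i with hf
  set V : ℝ → ℝ := fun t => Finset.univ.sup' Finset.univ_nonempty fun σ => f σ t with hV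
  have hfac : ∀ σ, ∀ T : ℝ, 0 ≤ T → AbsolutelyContinuousOnInterval (f σ) 0 T := fun σ T hT =>
    AbsolutelyContinuousOnInterval.finset_sum _ fun i _ => (hx.1 i T hT).const_mul _
  have hVac : ∀ T : ℝ, 0 ≤ T → AbsolutelyContinuousOnInterval V 0 T := fun T hT =>
    AbsolutelyContinuousOnInterval.finset_sup' _ _ fun σ _ => hfac σ T hT
  have hw : ∀ n : ℕ, 0 ≤ (2 * K) ^ n := fun n => by positivity
  have hVb : ∃ M : ℝ, ∀ t : ℝ, 0 ≤ t → |V t| ≤ M := by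
    refine ⟨∑ i : Fin N, (2 * K) ^ N * C, fun t ht => ?_⟩
    have hfb : ∀ σ, |f σ t| ≤ ∑ i : Fin N, (2 * K) ^ N * C := fun σ => by
      refine (Finset.abs_sum_le_sum_abs _ _).trans (Finset.sum_le_sum fun i _ => ?_)
      rw [abs_mul, abs_of_nonneg (hw _)]
      exact mul_le_mul (pow_le_pow_right₀ (by linarith) (σ i).2.le) (hC t ht i) (abs_nonneg _)
        (hw _)
    obtain ⟨σ, -, hσ⟩ := Finset.exists_mem_eq_sup' Finset.univ_nonempty fun σ => f σ t
    exact (congrArg abs hσ).trans_le (hfb σ)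
  have hdiss : ∀ᵐ t ∂(volume.restrict (Ici (0 : ℝ))),
      1 / 2 * ∑ i, ∑ j, A t i j * |x t j - x t i| ≤ - deriv V t := by
    have hxd : ∀ᵐ t ∂(volume.restrict (Ici (0 : ℝ))),
        ∀ i, DifferentiableAt ℝ (fun s => x s i) t :=
      ae_all_iff.2 fun i => ae_differentiableAt_Ici (hx.1 i)
    filter_upwards [hxd, ae_differentiableAt_Ici hVac, hx.ae_deriv_le_sum,
      ae_restrict_mem measurableSet_Ici] with t hxt hVt hle ht
    obtain ⟨σ, hmax, hσ⟩ := exists_perm_maximal_dissipation (hnonneg t ht) hK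
      (fun S => hcut S t ht) (x t)
    have hder : HasDerivAt (f σ)
        (∑ i, (2 * K) ^ (σ i : ℕ) * deriv (fun s => x s i) t) t :=
      HasDerivAt.fun_sum fun i _ => (hxt i).hasDerivAt.const_mul _
    -- `f σ` lies below `V` everywhere and touches it at `t`, since `σ` is maximal for `x t`.
    have heq : deriv V t = deriv (f σ) t := by
      refine deriv_eq_of_le_of_eq hder.differentiableAt hVt
        (fun s => Finset.le_sup' (fun σ => f σ s) (Finset.mem_univ σ)) (le_antisymm ?_ ?_)
      · exact Finset.le_sup' (fun σ => f σ t) (Finset.mem_univ σ)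
      · exact Finset.sup'_le _ _ fun τ _ => hmax τ
    rw [heq, hder.deriv]
    have : ∑ i, (2 * K) ^ (σ i : ℕ) * deriv (fun s => x s i) t ≤
        ∑ i, (2 * K) ^ (σ i : ℕ) * ∑ j, A t i j * (x t j - x t i) :=
      Finset.sum_le_sum fun i _ => mul_le_mul_of_nonneg_left (hle i) (hw _)
    linarith
  have hterm : ∀ t : ℝ, 0 ≤ t → ∀ i j, 0 ≤ A t i j * |x t j - x t i| := fun t ht i j =>
    mul_nonneg (hnonneg t ht i j) (abs_nonneg _)
  have hV' : IntegrableOn (deriv V) (Ici (0 : ℝ)) := by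
    refine integrableOn_deriv_of_le hVac hVb (φ := fun _ => 0) integrableOn_zero ?_
    filter_upwards [hdiss, ae_restrict_mem measurableSet_Ici] with t h ht
    have : 0 ≤ ∑ i, ∑ j, A t i j * |x t j - x t i| :=
      Finset.sum_nonneg fun i _ => Finset.sum_nonneg fun j _ => hterm t ht i j
    linarith
  refine (hV'.neg.const_mul 2).mono' ?_ ?_
  · refine (hmeas i j).aestronglyMeasurable.mul ?_
    exact ((hx.continuousOn j).sub (hx.continuousOn i)).aestronglyMeasurable measurableSet_Ici
  · filter_upwards [hdiss, ae_restrict_mem measurableSet_Ici] with t h ht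
    have h1 : A t i j * |x t j - x t i| ≤ ∑ i, ∑ j, A t i j * |x t j - x t i| :=
      (Finset.single_le_sum (f := fun j => A t i j * |x t j - x t i|)
        (fun j _ => hterm t ht i j) (Finset.mem_univ j)).trans
      (Finset.single_le_sum (f := fun i => ∑ j, A t i j * |x t j - x t i|)
        (fun i _ => Finset.sum_nonneg fun j _ => hterm t ht i j) (Finset.mem_univ i))
    rw [Real.norm_eq_abs, abs_mul, abs_of_nonneg (hnonneg t ht i j)]
    simp only [Pi.neg_apply]
    linarith

lemma IsSolution.integrableOn_deriv {x : ℝ → Fin N → ℝ} (hx : IsSolution A x)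
    (hb : IsBoundedOnHalfLine x)
    (hint : ∀ i j, IntegrableOn (fun t => A t i j * (x t j - x t i)) (Ici (0 : ℝ))) (i : Fin N) :
    IntegrableOn (fun t => deriv (fun s => x s i) t) (Ici (0 : ℝ)) := by
  obtain ⟨C, hC⟩ := hb
  refine integrableOn_deriv_of_le (hx.1 i) ⟨C, fun t ht => hC t ht i⟩
    (φ := fun t => ∑ j, A t i j * (x t j - x t i)) (integrable_finsetSum _ fun j _ => hint i j) ?_
  filter_upwards [hx.ae_deriv_le_sum] with t ht
  exact ht i

/-- Limits of a solution at the ends of a persistent arc agree if the interaction is integrable. -/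
lemma PersistentArc.limit_eq
    (hmeas : ∀ i j : Fin N, AEMeasurable (fun t => A t i j) (volume.restrict (Ici (0 : ℝ))))
    (hnonneg : ∀ t : ℝ, 0 ≤ t → ∀ i j : Fin N, 0 ≤ A t i j)
    (hbdd : ∃ C : ℝ, ∀ t : ℝ, 0 ≤ t → ∀ i j : Fin N, A t i j ≤ C)
    {x : ℝ → Fin N → ℝ} {x₀ : Fin N → ℝ} (hlim : Tendsto x atTop (𝓝 x₀)) {i j : Fin N}
    (hint : IntegrableOn (fun t => A t j i * (x t i - x t j)) (Ici (0 : ℝ)))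
    (harc : PersistentArc A i j) : x₀ i = x₀ j := by
  by_contra hne
  obtain ⟨C, hC⟩ := hbdd
  have hd : Tendsto (fun t => |x t i - x t j|) atTop (𝓝 |x₀ i - x₀ j|) :=
    (((tendsto_pi_nhds.1 hlim) i).sub ((tendsto_pi_nhds.1 hlim) j)).abs
  have hpos : 0 < |x₀ i - x₀ j| := abs_pos.2 (sub_ne_zero.2 hne)
  set d := |x₀ i - x₀ j|
  obtain ⟨T, hT⟩ := eventually_atTop.1 (hd.eventually (lt_mem_nhds (half_lt_self hpos)))
  set T' := max T 0
  have hT0 : 0 ≤ T' := le_max_right _ _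
  -- Boundedness of the weights serves only to give integrability on this initial interval.
  have h1 : IntegrableOn (fun t => A t j i) (Icc 0 T') := by
    refine Integrable.mono' (g := fun _ => C) (integrableOn_const (by simp)) ?_ ?_
    · exact (hmeas j i).aestronglyMeasurable.mono_set Icc_subset_Ici_self
    · filter_upwards [ae_restrict_mem measurableSet_Icc] with t ht
      rw [Real.norm_of_nonneg (hnonneg t ht.1 _ _)]
      exact hC t ht.1 _ _
  have hsub : Ici T' ⊆ Ici (0 : ℝ) := Ici_subset_Ici.2 hT0
  have h2 : IntegrableOn (fun t => A t j i) (Ici T') := by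
    refine ((hint.mono_set hsub).norm.const_mul (2 / d)).mono'
      ((hmeas j i).aestronglyMeasurable.mono_set hsub) ?_
    filter_upwards [ae_restrict_mem measurableSet_Ici] with t ht
    have ha := hnonneg t (hsub ht) j i
    rw [Real.norm_of_nonneg ha, norm_mul, Real.norm_of_nonneg ha, Real.norm_eq_abs]
    have h3 := hT t ((le_max_left _ _).trans ht)
    -- Past `T'` the gap exceeds `d / 2`, so the weight is at most `2 / d` times the interaction
    -- term.
    have h4 : 1 ≤ 2 / d * |x t i - x t j| := by
      rw [div_mul_eq_mul_div, le_div_iff₀ hpos]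
      linarith
    calc A t j i = A t j i * 1 := (mul_one _).symm
      _ ≤ A t j i * (2 / d * |x t i - x t j|) := mul_le_mul_of_nonneg_left h4 ha
      _ = _ := by ring
  have h3 : IntegrableOn (fun t => A t j i) (Ici 0) := by
    rw [← Icc_union_Ici_eq_Ici hT0]
    exact h1.union h2
  exact (h3.lintegral_lt_top).ne harc

/-- If no persistent arc leaves `S`, the inequality has a bounded solution vanishing on `S` and
bounded below by a positive constant off `S`. -/
lemma exists_isSolution_of_no_persistentArc
    (hmeas : ∀ i j : Fin N, AEMeasurable (fun t => A t i j) (volume.restrict (Ici (0 : ℝ))))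
    (hnonneg : ∀ t : ℝ, 0 ≤ t → ∀ i j : Fin N, 0 ≤ A t i j)
    (S : Finset (Fin N)) (hS : ∀ i ∈ S, ∀ j ∉ S, ¬ PersistentArc A i j) :
    ∃ x : ℝ → Fin N → ℝ, IsSolution A x ∧ IsBoundedOnHalfLine x ∧
      (∀ t, ∀ i ∈ S, x t i = 0) ∧ ∃ ε > 0, ∀ t : ℝ, 0 ≤ t → ∀ j ∉ S, ε ≤ x t j := by
  -- The total influence of `S` on its complement is integrable. The solution off `S` is `exp (-∫
  -- h)`: it decays at rate `h`, which dominates the pull of `S` on each single node, yet stays away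
  -- from zero.
  set h : ℝ → ℝ := fun t => ∑ j ∈ Sᶜ, ∑ i ∈ S, A t j i with hh
  have hh0 : ∀ t : ℝ, 0 ≤ t → 0 ≤ h t := fun t ht =>
    Finset.sum_nonneg fun _ _ => Finset.sum_nonneg fun _ _ => hnonneg t ht _ _
  have hint : IntegrableOn h (Ici (0 : ℝ)) := by
    refine integrable_finsetSum _ fun j hj => integrable_finsetSum _ fun i hi => ?_
    refine ⟨(hmeas j i).aestronglyMeasurable, ?_⟩
    rw [hasFiniteIntegral_iff_ofReal]
    · exact lt_top_iff_ne_top.2 (hS i hi j (Finset.mem_compl.1 hj))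
    · filter_upwards [ae_restrict_mem measurableSet_Ici] with t ht
      exact hnonneg t ht j i
  have hint' : IntegrableOn h (Ioi 0) := hint.mono_set Ioi_subset_Ici_self
  set H : ℝ → ℝ := fun t => ∫ s in (0 : ℝ)..t, h s with hH
  have hhT : ∀ T : ℝ, 0 ≤ T → IntervalIntegrable h volume 0 T := fun T hT => by
    rw [intervalIntegrable_iff_integrableOn_Ioc_of_le hT]
    exact hint'.mono_set Ioc_subset_Ioi_self
  have hH0 : ∀ t : ℝ, 0 ≤ t → 0 ≤ H t := fun t ht =>
    intervalIntegral.integral_nonneg ht fun s hs => hh0 s hs.1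
  have hHM : ∀ t : ℝ, 0 ≤ t → H t ≤ ∫ s in Ioi (0 : ℝ), h s := fun t ht => by
    rw [hH]
    simp only
    rw [intervalIntegral.integral_of_le ht]
    refine setIntegral_mono_set hint' ?_ Ioc_subset_Ioi_self.eventuallyLE
    filter_upwards [ae_restrict_mem measurableSet_Ioi] with s hs
    exact hh0 s (le_of_lt hs)
  have hHac : ∀ T : ℝ, 0 ≤ T → AbsolutelyContinuousOnInterval H 0 T := fun T hT =>
    (hhT T hT).absolutelyContinuousOnInterval_intervalIntegral (by simp)
  set v : ℝ → ℝ := fun t => Real.exp (- H t) with hv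
  have hvac : ∀ T : ℝ, 0 ≤ T → AbsolutelyContinuousOnInterval v 0 T := fun T hT => by
    -- `exp (-u)` is not globally Lipschitz, but `H` takes values in `[0, ∞)`.
    have hlip : LipschitzOnWith 1 (fun u => Real.exp (-u)) (Ici (0 : ℝ)) := by
      refine (convex_Ici 0).lipschitzOnWith_of_nnnorm_hasDerivWithin_le
        (f' := fun u => Real.exp (-u) * -1)
        (fun u _ => ((hasDerivAt_neg u).exp).hasDerivWithinAt) fun u hu => ?_
      rw [← NNReal.coe_le_coe, coe_nnnorm]
      simpa using hu
    refine hlip.comp_absolutelyContinuousOnInterval (fun t ht => ?_) (hHac T hT)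
    rw [uIcc_of_le hT] at ht
    exact hH0 t ht.1
  have hvd : ∀ᵐ t ∂(volume.restrict (Ici (0 : ℝ))), HasDerivAt v (- (h t * v t)) t := by
    rw [ae_restrict_iff' measurableSet_Ici]
    have hHd : ∀ᵐ t : ℝ, ∀ n : ℕ, t ∈ uIcc (0 : ℝ) n → ∀ c ∈ uIcc (0 : ℝ) n,
        HasDerivAt (fun t => ∫ s in c..t, h s) (h t) t :=
      ae_all_iff.2 fun n => (hhT n n.cast_nonneg).ae_hasDerivAt_integral
    filter_upwards [hHd] with t ht h0
    obtain ⟨n, hn⟩ := exists_nat_ge t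
    have hd : HasDerivAt H (h t) t :=
      ht n (by rw [uIcc_of_le n.cast_nonneg]; exact ⟨h0, hn⟩) 0 left_mem_uIcc
    have hvt : HasDerivAt v (v t * - h t) t := hd.neg.exp
    rwa [mul_neg, mul_comm] at hvt
  refine ⟨fun t i => if i ∈ S then 0 else v t, ⟨fun i T hT => ?_, ?_⟩, ⟨1, fun t ht i => ?_⟩,
    fun t i hi => by simp [hi], Real.exp (- ∫ s in Ioi (0 : ℝ), h s), Real.exp_pos _,
    fun t ht j hj => ?_⟩
  · by_cases hi : i ∈ S
    · simpa [hi] using (LipschitzWith.const (0 : ℝ)).lipschitzOnWith.absolutelyContinuousOnInterval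
    · simpa [hi] using hvac T hT
  · filter_upwards [hvd, ae_restrict_mem measurableSet_Ici] with t htd ht i
    rw [neg_laplacian_mulVec]
    have hv0 : 0 ≤ v t := (Real.exp_pos _).le
    by_cases hi : i ∈ S
    · simp only [hi, if_true, deriv_const]
      refine Finset.sum_nonneg fun j _ => mul_nonneg (hnonneg t ht i j) ?_
      split_ifs <;> simp [hv0]
    · simp only [hi, if_false, htd.deriv]
      have h1 : ∑ j, A t i j * ((if j ∈ S then 0 else v t) - v t) = - ((∑ j ∈ S, A t i j) * v t) := by
        rw [Finset.sum_mul, ← Finset.sum_neg_distrib, ← Finset.univ_inter S, ← Finset.sum_ite_mem]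
        refine Finset.sum_congr rfl fun j _ => ?_
        split_ifs <;> simp_all
      rw [h1]
      refine neg_le_neg (mul_le_mul_of_nonneg_right ?_ hv0)
      exact Finset.single_le_sum (f := fun j => ∑ i ∈ S, A t j i)
        (fun j _ => Finset.sum_nonneg fun _ _ => hnonneg t ht _ _) (Finset.mem_compl.2 hi)
  · by_cases hi : i ∈ S
    · simp [hi]
    · simpa [hi, abs_of_pos (Real.exp_pos _), hv] using hH0 t ht
  · simp only [hj, if_false, hv]
    exact Real.exp_le_exp.2 (neg_le_neg (hHM t ht))

end

theorem theorem3 {N : ℕ} (A : ℝ → Matrix (Fin N) (Fin N) ℝ)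
    (hmeas : ∀ i j : Fin N, AEMeasurable (fun t => A t i j) (volume.restrict (Ici (0 : ℝ))))
    (hnonneg : ∀ t : ℝ, 0 ≤ t → ∀ i j : Fin N, 0 ≤ A t i j)
    (hloops : ∀ t : ℝ, 0 ≤ t → ∀ i : Fin N, A t i i = 0)
    (hbdd : ∃ C : ℝ, ∀ t : ℝ, 0 ≤ t → ∀ i j : Fin N, A t i j ≤ C)
    (hcut : CutBalanced A) :
    Dichotomic A ∧
    (∀ x : ℝ → Fin N → ℝ, IsSolution A x → IsBoundedOnHalfLine x →
      (∀ i j : Fin N, IntegrableOn (fun t => A t i j * (x t j - x t i)) (Ici (0 : ℝ))) ∧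
      (∀ i : Fin N, IntegrableOn (fun t => deriv (fun s => x s i) t) (Ici (0 : ℝ))) ∧
      (∀ i : Fin N, IntegrableOn
        (fun t => - (laplacian (A t)).mulVec (x t) i - deriv (fun s => x s i) t)
        (Ici (0 : ℝ)))) ∧
    (ConsensusDichotomic A ↔ InfinitelyStronglyConnected A) := by
  have hint := fun x (hx : IsSolution A x) (hb : IsBoundedOnHalfLine x) =>
    hx.integrableOn_interaction hmeas hnonneg hcut hb
  have hderiv := fun x (hx : IsSolution A x) (hb : IsBoundedOnHalfLine x) =>
    hx.integrableOn_deriv hb (hint x hx hb)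
  have hdich : Dichotomic A := fun x hx hb => by
    choose l hl using fun i => tendsto_of_integrableOn_deriv (hx.1 i) (hderiv x hx hb i)
    exact ⟨l, tendsto_pi_nhds.2 hl⟩
  refine ⟨hdich, fun x hx hb => ⟨hint x hx hb, hderiv x hx hb, fun i => ?_⟩, fun hcons i j => ?_,
    fun hisc => ⟨hdich, fun x hx hb x₀ hlim => ?_⟩⟩
  · simp only [neg_laplacian_mulVec]
    exact (integrable_finsetSum _ fun j _ => hint x hx hb i j).sub (hderiv x hx hb i)
  · by_contra hij
    classical
    -- The set reachable from `i` contains `i` but not `j`, so the limit would be `0` at `i` and at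
    -- least `ε` at `j`.
    obtain ⟨x, hx, hb, h0, ε, hε, hpos⟩ := exists_isSolution_of_no_persistentArc hmeas hnonneg
      (Finset.univ.filter fun k => Relation.ReflTransGen (PersistentArc A) i k)
      (fun k hk l hl harc => by
        simp only [Finset.mem_filter, Finset.mem_univ, true_and] at hk hl
        exact hl (hk.tail harc))
    obtain ⟨x₀, hlim⟩ := hcons.1 x hx hb
    obtain ⟨c, rfl⟩ := hcons.2 x hx hb x₀ hlim
    have hi := (tendsto_pi_nhds.1 hlim) i
    have hj := (tendsto_pi_nhds.1 hlim) j
    have hc : c = 0 := by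
      refine tendsto_nhds_unique hi ?_
      simp only [h0 _ i (by simp [Relation.ReflTransGen.refl])]
      exact tendsto_const_nhds
    have hc' : ε ≤ c := by
      refine ge_of_tendsto hj ?_
      filter_upwards [eventually_ge_atTop 0] with t ht
      exact hpos t ht j (by simpa using hij)
    linarith
  · rcases N with _ | n
    · exact ⟨0, funext fun i => i.elim0⟩
    · refine ⟨x₀ 0, funext fun j => ?_⟩
      have hpath := hisc 0 j
      induction hpath with
      | refl => rfl
      | tail _ harc ih =>
        rw [← ih]
        exact (harc.limit_eq hmeas hnonneg hbdd hlim (hint x hx hb _ _)).symm
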